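/- Let $\mathbb{T}^2=\mathbb{R}^2/(2\pi\mathbb{Z})^2$ and let $\Delta=\{(x,x):x\in\mathbb{T}^2\}$. For $K>0$ and $\omega=(\omega^1,\omega^2)\in[0,2\pi)^2$ let $f_\omega=f_\omega^V\circ f_\omega^H$ be the randomized Chirikov standard map on $\mathbb{T}^2$, where $$f^H_\omega(x_1,x_2)=(x_1+K\sin(x_2-\omega^1),\,x_2),\qquad f^V_\omega(x_1,x_2)=(x_1,\,x_2+x_1-\omega^2)\pmod{2\pi}.$$ Let $\omega_1,\omega_2,\dots$ be independent and uniformly distributed on $[0,2\pi)^2$. For $z=(x,y)\in(\mathbb{T}^2\times\mathbb{T}^2)\setminus\Delta$ and a Borel set $A\subset(\mathbb{T}^2\times\mathbb{T}^2)\setminus\Delta$ let $$P^{(2),n}(z,A)=\mathbb{P}\bigl((f_{\omega_n}\circ\cdots\circ f_{\omega_1}(x),\,f_{\omega_n}\circ\cdots\circ f_{\omega_1}(y))\in A\bigr)$$ be the $n$-step transition kernel of the two-point process. Let $B(z,r)$ denote the ball of radius $r$ about $z$ in $(\mathbb{T}^2\times\mathbb{T}^2)\setminus\Delta$ for the flat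 Euclidean distance, let $\operatorname{Leb}$ be Lebesgue measure (of total mass $(2\pi)^4$), and let $z_*=((0,0),(0,\pi))$. **Proposition.** For every $K_0>0$ there exist positive constants $C_1,C_2,C_3,C_4$, depending only on $K_0$ (in particular independent of $K$ and $n$), such that for all $K\ge K_0$, all integers $n\ge 4$, all $z\in B(z_*,C_1K^{-130})$ and all Borel sets $A$, $$P^{(2),n}(z,A)\ \ge\ c_1(K)^{\lfloor n/4\rfloor-1}\,C_2K^{-780}\,\mu(A),$$ where $$c_1(K)=C_3K^{-764},\qquad \mu=K^{-288}\operatorname{Leb}\bigl(B(z_*,C_4K^{-55})\cap\,\cdot\,\bigr).$$ -/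

import Mathlib

open Real MeasureTheory
open scoped ENNReal

namespace RandomChirikov

noncomputable section

instance factTwoPiPos : Fact ((0 : ℝ) < 2 * π) := ⟨Real.two_pi_pos⟩

/-- The circle `ℝ / 2πℤ`, with its quotient metric and with Lebesgue measure of total mass `2π`. -/
abbrev Circ : Type := AddCircle (2 * π)

/-- The torus `𝕋² = ℝ² / (2πℤ)²`. -/
abbrev Torus : Type := Circ × Circ

/-- The sine function on `ℝ / 2πℤ`. -/
def sinT : Circ → ℝ := Real.sin_periodic.lift

/-- The horizontal map `(x₁, x₂) ↦ (x₁ + K sin (x₂ - ω¹), x₂)`. -/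
def fH (K : ℝ) (ω : ℝ × ℝ) (x : Torus) : Torus :=
  (x.1 + ((K * sinT (x.2 - (ω.1 : Circ)) : ℝ) : Circ), x.2)

/-- The vertical map `(x₁, x₂) ↦ (x₁, x₂ + x₁ - ω²)`. -/
def fV (ω : ℝ × ℝ) (x : Torus) : Torus :=
  (x.1, x.2 + x.1 - (ω.2 : Circ))

/-- The randomized Chirikov standard map `f_ω = f_ω^V ∘ f_ω^H`. -/
def f (K : ℝ) (ω : ℝ × ℝ) (x : Torus) : Torus := fV ω (fH K ω x)

/-- The composition `f_{ω_n} ∘ ⋯ ∘ f_{ω_1}`; here `ω (Fin.last n)` is the last phase `ω_{n+1}`. -/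
def iter (K : ℝ) : (n : ℕ) → (Fin n → ℝ × ℝ) → Torus → Torus
  | 0, _, x => x
  | n + 1, ω, x => f K (ω (Fin.last n)) (iter K n (Fin.init ω) x)

/-- The uniform distribution of one phase on `[0, 2π)²`. -/
def phaseLaw : Measure (ℝ × ℝ) :=
  ProbabilityTheory.cond volume (Set.Ico (0 : ℝ) (2 * π) ×ˢ Set.Ico (0 : ℝ) (2 * π))

/-- The joint law of `n` independent phases. -/
def phasesLaw (n : ℕ) : Measure (Fin n → ℝ × ℝ) := Measure.pi fun _ => phaseLaw

/-- The state space `(𝕋² × 𝕋²) ∖ Δ` of the two-point process. -/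
abbrev TwoPt : Type := {z : Torus × Torus // z.1 ≠ z.2}

theorem fH_injective (K : ℝ) (ω : ℝ × ℝ) : Function.Injective (fH K ω) := by
  rintro ⟨a, b⟩ ⟨c, d⟩ h
  simp only [fH, Prod.mk.injEq] at h
  obtain ⟨h1, rfl⟩ := h
  simpa using h1

theorem fV_injective (ω : ℝ × ℝ) : Function.Injective (fV ω) := by
  rintro ⟨a, b⟩ ⟨c, d⟩ h
  simp only [fV, Prod.mk.injEq] at h
  obtain ⟨rfl, h2⟩ := h
  simpa using h2

theorem f_injective (K : ℝ) (ω : ℝ × ℝ) : Function.Injective (f K ω) :=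
  (fV_injective ω).comp (fH_injective K ω)

theorem iter_injective (K : ℝ) : ∀ (n : ℕ) (ω : Fin n → ℝ × ℝ), Function.Injective (iter K n ω)
  | 0, _ => fun _ _ h => h
  | n + 1, ω => (f_injective K _).comp (iter_injective K n (Fin.init ω))

/-- The `n`-step two-point map `Φ_{2n}(z, ω_1, …, ω_n)`. -/
def Phi (K : ℝ) (n : ℕ) (z : TwoPt) (ω : Fin n → ℝ × ℝ) : TwoPt :=
  ⟨(iter K n ω z.1.1, iter K n ω z.1.2), fun h => z.2 (iter_injective K n ω h)⟩

/-- The `n`-step transition kernel `P^{(2),n}(z, ·)`, the law of `Φ_{2n}(z, ω_1, …, ω_n)`. -/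
def P2 (K : ℝ) (n : ℕ) (z : TwoPt) : Measure TwoPt := (phasesLaw n).map (Phi K n z)

theorem continuous_sinT : Continuous sinT :=
  continuous_coinduced_dom.mpr Real.continuous_sin

theorem continuous_f (K : ℝ) : Continuous fun p : (ℝ × ℝ) × Torus => f K p.1 p.2 := by
  have hc : Continuous fun t : ℝ => (t : Circ) := AddCircle.continuous_mk' _
  have hs := continuous_sinT
  unfold f fV fH
  fun_prop

theorem continuous_iter (K : ℝ) (x : Torus) :
    ∀ n : ℕ, Continuous fun ω : Fin n → ℝ × ℝ => iter K n ω x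
  | 0 => continuous_const
  | n + 1 => by
    have h1 : Continuous fun ω : Fin (n + 1) → ℝ × ℝ => (Fin.init ω : Fin n → ℝ × ℝ) :=
      continuous_pi fun i => continuous_apply (Fin.castSucc i)
    exact (continuous_f K).comp
      ((continuous_apply (Fin.last n)).prodMk ((continuous_iter K x n).comp h1))

theorem measurable_Phi (K : ℝ) (n : ℕ) (z : TwoPt) : Measurable (Phi K n z) :=
  (((continuous_iter K z.1.1 n).measurable).prodMk
    ((continuous_iter K z.1.2 n).measurable)).subtype_mk

theorem P2_apply (K : ℝ) (n : ℕ) (z : TwoPt) {A : Set TwoPt} (hA : MeasurableSet A) :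
    P2 K n z A = phasesLaw n {ω | Phi K n z ω ∈ A} :=
  Measure.map_apply (measurable_Phi K n z) hA

/-- The Euclidean (flat) distance of `𝕋² × 𝕋² = 𝕋⁴`. -/
def flatDist (z w : Torus × Torus) : ℝ :=
  √(dist z.1.1 w.1.1 ^ 2 + dist z.1.2 w.1.2 ^ 2 + dist z.2.1 w.2.1 ^ 2 + dist z.2.2 w.2.2 ^ 2)

/-- The ball `B(z, r)` in the state space. -/
def ball (z : TwoPt) (r : ℝ) : Set TwoPt := {w | flatDist w.1 z.1 < r}

/-- Lebesgue measure on the state space. -/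
def leb : Measure TwoPt := Measure.comap Subtype.val (volume : Measure (Torus × Torus))

theorem pi_ne_zero_circ : (0 : Circ) ≠ ((π : ℝ) : Circ) := by
  intro h
  obtain ⟨n, hn⟩ := (AddCircle.coe_eq_zero_iff (2 * π)).mp h.symm
  rw [zsmul_eq_mul] at hn
  have h2 : ((n * 2 : ℤ) : ℝ) = ((1 : ℤ) : ℝ) := by
    push_cast
    exact mul_right_cancel₀ Real.pi_ne_zero (by linarith)
  have h3 : n * 2 = 1 := by exact_mod_cast h2
  omega

/-- The reference point `z_* = ((0, 0), (0, π))`. -/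
def zStar : TwoPt :=
  ⟨((0, 0), (0, ((π : ℝ) : Circ))), fun h => pi_ne_zero_circ (congrArg Prod.snd h)⟩

end

end RandomChirikov

/-!
The difference `d = y - x` evolves by itself: writing `d₂ = π + β`, successive values of `β` satisfy
`β'' - 2 β' + β = 2 K cos (β' / 2) cos θ`, and the mean `(x₁ + y₁) / 2` changes by
`-K sin (β / 2) sin θ`, where `θ = x₂ - ω¹ + d₂ / 2`. So the phases may be replaced by the values
of `β` as controls, and the point `zStar`, where `β = 0`, is fixed for suitable phases. In three
steps the last two values of `β` are determined by the target, and the remaining one moves the mean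
at rate of order `K`. The intermediate value theorem therefore produces phases for every start and
every target at distance of order `1 / K` from `zStar` (`exists_three_phases`).

This controllability gives a density without any Jacobian (`ofReal_mul_volume_le_P2_three`): the map
from the six phase coordinates to the two end points and the two free phase coordinates is
`(3 + 2 K) ^ 3`-Lipschitz and covers a product set, and a Lipschitz map of `ℝ⁶` enlarges volumes at
most by the sixth power of its Lipschitz constant. Phases of size `ε ∼ K⁻⁵` move a point within `ε`
of `zStar` by less than order `1 / K` in four steps (`ofReal_pow_le_P2_ball`), so any number of
steps from four to seven has the same kind of lower bound (`mul_leb_le_P2_of_lt`). Restricting to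
trajectories that return to the `ε`-ball after each block of four steps
(`mul_P2_le_P2_add`) yields the bound for all `n` (`pow_mul_leb_le_P2`). The powers of `K` obtained
in this way, `58` for the density and `78` for the return probability, are smaller than the
required ones, and the difference is absorbed into the constants since `K ≥ K₀`.
-/

namespace RandomChirikov

noncomputable section

/-! ### The real lift of the map -/

/-- The lift of `f` to the universal cover `ℝ²` of the torus. -/
def fReal (K : ℝ) (ω x : ℝ × ℝ) : ℝ × ℝ :=
  (x.1 + K * sin (x.2 - ω.1), x.2 + (x.1 + K * sin (x.2 - ω.1)) - ω.2)

/-- The covering map `ℝ² → 𝕋²`. -/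
def toTorus (x : ℝ × ℝ) : Torus := ((x.1 : Circ), (x.2 : Circ))

theorem f_toTorus (K : ℝ) (ω x : ℝ × ℝ) : f K ω (toTorus x) = toTorus (fReal K ω x) := by
  have h : sinT ((x.2 : Circ) - (ω.1 : Circ)) = sin (x.2 - ω.1) := by
    rw [← AddCircle.coe_sub]
    rfl
  simp only [f, fV, fH, toTorus, fReal, h, AddCircle.coe_add, AddCircle.coe_sub]

theorem fReal_snd (K : ℝ) (ω x : ℝ × ℝ) : (fReal K ω x).2 = x.2 + (fReal K ω x).1 - ω.2 := rfl

theorem lipschitzWith_fReal {K : ℝ} (hK : 0 ≤ K) :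
    LipschitzWith (3 + 2 * K).toNNReal fun p : (ℝ × ℝ) × (ℝ × ℝ) => fReal K p.1 p.2 := by
  refine LipschitzWith.of_dist_le' fun p q => ?_
  obtain ⟨⟨w, s⟩, x, y⟩ := p
  obtain ⟨⟨w', s'⟩, x', y'⟩ := q
  simp only [fReal, Prod.dist_eq, Real.dist_eq]
  set M := max (max |w - w'| |s - s'|) (max |x - x'| |y - y'|)
  have hw : |w - w'| ≤ M := le_max_of_le_left (le_max_left _ _)
  have hs : |s - s'| ≤ M := le_max_of_le_left (le_max_right _ _)
  have hx : |x - x'| ≤ M := le_max_of_le_right (le_max_left _ _)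
  have hy : |y - y'| ≤ M := le_max_of_le_right (le_max_right _ _)
  have hM : 0 ≤ M := (abs_nonneg _).trans hw
  have hsin : |sin (y - w) - sin (y' - w')| ≤ 2 * M := by
    refine (Real.abs_sin_sub_sin_le _ _).trans ?_
    rw [abs_le] at *
    constructor <;> linarith
  have hk : |K * (sin (y - w) - sin (y' - w'))| ≤ K * (2 * M) := by
    rw [abs_mul, abs_of_nonneg hK]
    exact mul_le_mul_of_nonneg_left hsin hK
  rw [abs_le] at *
  refine max_le ?_ ?_ <;> rw [abs_le] <;> constructor <;> nlinarith

theorem dist_fReal_fReal_le {K : ℝ} (hK : 0 ≤ K) {ω ω' x x' : ℝ × ℝ} {ε : ℝ}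
    (hω : dist ω ω' ≤ ε) (hx : dist x x' ≤ ε) :
    dist (fReal K ω x) (fReal K ω' x') ≤ (3 + 2 * K) * ε := by
  have h := (lipschitzWith_fReal hK).dist_le_mul (ω, x) (ω', x')
  rw [Real.coe_toNNReal _ (by linarith)] at h
  exact h.trans (mul_le_mul_of_nonneg_left (max_le hω hx) (by linarith))

/-! ### Three steps between prescribed points -/

theorem pi_div_three_le_arccos {c : ℝ} (hc : c ≤ 1 / 2) : π / 3 ≤ arccos c := by
  rw [← Real.arccos_cos (x := π / 3) (by positivity) (by linarith [pi_pos]), cos_pi_div_three]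
  exact Real.arccos_le_arccos hc

theorem arccos_le_two_pi_div_three {c : ℝ} (hc : -(1 / 2) ≤ c) : arccos c ≤ 2 * π / 3 := by
  have h := pi_div_three_le_arccos (c := -c) (by linarith)
  rw [Real.arccos_neg] at h
  linarith

/-- The change of the mean `(x₁ + y₁) / 2` in a step that starts with `y₂ - x₂ = π + β` and whose
phase is chosen so that `y₁ - x₁` changes by `κ`. -/
def meanKick (K β κ : ℝ) : ℝ := K * (√(1 - (κ / (2 * K * cos (β / 2))) ^ 2) * sin (β / 2))

theorem half_le_cos_half {β : ℝ} (hβ : |β| ≤ 1 / 10) : 1 / 2 ≤ cos (β / 2) := by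
  have h := Real.one_sub_sq_div_two_le_cos (x := β / 2)
  rw [abs_le] at hβ
  nlinarith

theorem abs_div_two_mul_cos_le {K β κ : ℝ} (hK : 0 < K) (hβ : |β| ≤ 1 / 10) (hκ : |κ| ≤ K / 2) :
    |κ / (2 * K * cos (β / 2))| ≤ 1 / 2 := by
  have h := half_le_cos_half hβ
  have h' : 0 < 2 * K * cos (β / 2) := by positivity
  rw [abs_div, abs_of_pos h', div_le_iff₀ h']
  nlinarith

theorem abs_meanKick_le {K β κ : ℝ} (hK : 0 < K) : |meanKick K β κ| ≤ K * (|β| / 2) := by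
  unfold meanKick
  rw [abs_mul, abs_mul, abs_of_pos hK, abs_of_nonneg (sqrt_nonneg _)]
  have h1 : √(1 - (κ / (2 * K * cos (β / 2))) ^ 2) ≤ 1 := by
    apply Real.sqrt_le_one.2
    linarith [sq_nonneg (κ / (2 * K * cos (β / 2)))]
  have h2 : |sin (β / 2)| ≤ |β| / 2 := by
    refine Real.abs_sin_le_abs.trans ?_
    rw [abs_div, abs_two]
  refine mul_le_mul_of_nonneg_left ?_ hK.le
  calc _ ≤ 1 * |sin (β / 2)| := mul_le_mul_of_nonneg_right h1 (abs_nonneg _)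
    _ ≤ _ := by rwa [one_mul]

theorem meanKick_neg (K β κ : ℝ) : meanKick K (-β) κ = -meanKick K β κ := by
  simp only [meanKick, neg_div, cos_neg, sin_neg]
  ring

theorem le_meanKick {K β κ : ℝ} (hK : 0 < K) (h0 : 0 ≤ β) (hβ : |β| ≤ 1 / 10)
    (hκ : |κ| ≤ K / 2) : K * (β / 8) ≤ meanKick K β κ := by
  have hc := abs_div_two_mul_cos_le hK hβ hκ
  unfold meanKick
  set c := κ / (2 * K * cos (β / 2))
  have h1 : 1 / 2 ≤ √(1 - c ^ 2) := by
    apply Real.le_sqrt_of_sq_le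
    rw [abs_le] at hc
    nlinarith
  have h2 : β / 4 ≤ sin (β / 2) := by
    rw [abs_of_nonneg h0] at hβ
    have h := Real.mul_le_sin (x := β / 2) (by linarith) (by linarith [Real.pi_gt_three])
    have h3 : 1 / 2 ≤ 2 / π := by
      rw [div_le_div_iff₀ (by norm_num) pi_pos]
      linarith [Real.pi_le_four]
    nlinarith
  refine mul_le_mul_of_nonneg_left ?_ hK.le
  nlinarith

/-- The phase realizing a prescribed change `κ` of `y₁ - x₁`. The branch of the inverse cosine is
the one for which the phase is near `x₂ + π`, away from the ends of `[0, 2π)`. -/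
theorem exists_phase_of_kick {K : ℝ} (hK : 0 < K) {x y : ℝ × ℝ} {β κ : ℝ}
    (hxy : y.2 - x.2 = π + β) (hβ : |β| ≤ 1 / 10) (hκ : |κ| ≤ K / 2) :
    ∃ w : ℝ, x.2 + 5 * π / 6 - 1 / 20 ≤ w ∧ w ≤ x.2 + 7 * π / 6 + 1 / 20 ∧
      ∀ s, (fReal K (w, s) x).1 = x.1 + (meanKick K β κ - κ / 2) ∧
        (fReal K (w, s) y).1 = y.1 + (meanKick K β κ + κ / 2) := by
  simp only [fReal, add_right_inj]
  have hc := abs_div_two_mul_cos_le hK hβ hκ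
  have hcos := half_le_cos_half hβ
  unfold meanKick
  set c := κ / (2 * K * cos (β / 2)) with hcdef
  have hκ' : κ = 2 * K * cos (β / 2) * c := by
    rw [hcdef]
    field_simp
  rw [abs_le] at hc hβ
  have ha := pi_div_three_le_arccos hc.2
  have hb := arccos_le_two_pi_div_three hc.1
  have hcA : cos (arccos c) = c := Real.cos_arccos (by linarith) (by linarith)
  have hsA : sin (arccos c) = √(1 - c ^ 2) := Real.sin_arccos c
  have hx : x.2 - (x.2 + arccos c + (π + β) / 2) = -(arccos c + β / 2 + π / 2) := by ring
  have hy : y.2 - (x.2 + arccos c + (π + β) / 2) = β / 2 - arccos c + π / 2 := by linarith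
  refine ⟨x.2 + arccos c + (π + β) / 2, by linarith, by linarith, fun _ => ⟨?_, ?_⟩⟩
  · rw [hx, sin_neg, sin_add_pi_div_two, cos_add, hcA, hsA, hκ']
    ring
  · rw [hy, sin_add_pi_div_two, cos_sub, hcA, hsA, hκ']
    ring

/-- The second-coordinate difference after the first step can be chosen so that the mean first
coordinate after three steps is `E`: the second kick of the mean grows at rate `K` in `β`, and
dominates the other two. -/
theorem exists_meanKick_sum_eq {K η r β' β₀ β₂ β₃ e E : ℝ} (hK : 0 < K) (hη0 : 0 ≤ η)
    (hη : η ≤ 1 / 20) (hηK : η ≤ K / 20) (hr : r ≤ η / 100) (hrK : r ≤ K * (η / 100))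
    (hβ' : |β'| ≤ 4 * r) (hβ₀ : |β₀| ≤ 2 * r) (hβ₂ : |β₂| ≤ 4 * r)
    (he : |e| ≤ r) (hE : |E| ≤ r) :
    ∃ β : ℝ, |β| ≤ η ∧
      e + meanKick K β₀ (β - 2 * β₀ + β') + meanKick K β (β₂ - 2 * β + β₀) +
        meanKick K β₂ (β₃ - 2 * β₂ + β) = E := by
  set F : ℝ → ℝ := fun β => e + meanKick K β₀ (β - 2 * β₀ + β') +
    meanKick K β (β₂ - 2 * β + β₀) + meanKick K β₂ (β₃ - 2 * β₂ + β) with hF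
  have h1 : ∀ κ, |meanKick K β₀ κ| ≤ K * r := fun κ => (abs_meanKick_le hK).trans
    (mul_le_mul_of_nonneg_left (by linarith) hK.le)
  have h2 : ∀ κ, |meanKick K β₂ κ| ≤ K * (2 * r) := fun κ => (abs_meanKick_le hK).trans
    (mul_le_mul_of_nonneg_left (by linarith) hK.le)
  have hKr : K * r ≤ K * (η / 100) := mul_le_mul_of_nonneg_left hr hK.le
  simp only [abs_le] at *
  have hup : E ≤ F η := by
    have h3 := le_meanKick (κ := β₂ - 2 * η + β₀) hK hη0
      (abs_le.2 ⟨by linarith, by linarith⟩) (abs_le.2 ⟨by linarith, by linarith⟩)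
    have h1' := h1 (η - 2 * β₀ + β')
    have h2' := h2 (β₃ - 2 * β₂ + η)
    simp only [hF]
    nlinarith
  have hlo : F (-η) ≤ E := by
    have h3 := le_meanKick (κ := β₂ - 2 * (-η) + β₀) hK hη0
      (abs_le.2 ⟨by linarith, by linarith⟩) (abs_le.2 ⟨by linarith, by linarith⟩)
    have h1' := h1 (-η - 2 * β₀ + β')
    have h2' := h2 (β₃ - 2 * β₂ + -η)
    simp only [hF, meanKick_neg]
    nlinarith
  have hcont : ContinuousOn F (Set.Icc (-η) η) := by
    have hne : ∀ β ∈ Set.Icc (-η) η, 2 * K * cos (β / 2) ≠ 0 := fun β hβ => by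
      have := half_le_cos_half (β := β) (abs_le.2 ⟨by linarith [hβ.1], by linarith [hβ.2]⟩)
      positivity
    simp only [hF, meanKick]
    have hdiv : ContinuousOn (fun β => (β₂ - 2 * β + β₀) / (2 * K * cos (β / 2)))
        (Set.Icc (-η) η) := ContinuousOn.div (by fun_prop) (by fun_prop) hne
    fun_prop
  obtain ⟨β, hβ, hβE⟩ := intermediate_value_Icc (by linarith) hcont ⟨hlo, hup⟩
  exact ⟨β, hβ, hβE⟩

/-- Every target close to `((0, 0), (0, π))` is reached in three steps from every starting point
close to it, whatever the second entries `s₁`, `s₂` of the first two phases. The target is shifted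
by `-2π` in the second coordinates so that the last phase lies in `[0, 2π)`; the
range of `s₁`, `s₂` keeps the other phases there too. -/
theorem exists_three_phases {K η r : ℝ} (hK : 0 < K) (hη0 : 0 ≤ η) (hη : η ≤ 1 / 20)
    (hKη : K * η ≤ 1 / 20) (hηK : η ≤ K / 20) (hr : r ≤ η / 100) (hrK : r ≤ K * (η / 100))
    {x y X Y : ℝ × ℝ} (hx₁ : |x.1| ≤ r) (hx₂ : |x.2| ≤ r) (hy₁ : |y.1| ≤ r)
    (hy₂ : |y.2 - π| ≤ r) (hX₁ : |X.1| ≤ r) (hX₂ : |X.2| ≤ r) (hY₁ : |Y.1| ≤ r)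
    (hY₂ : |Y.2 - π| ≤ r) {s₁ s₂ : ℝ} (hs₁ : s₁ ∈ Set.Icc (1 / 2 : ℝ) 1)
    (hs₂ : s₂ ∈ Set.Icc (1 / 2 : ℝ) 1) :
    ∃ w₁ ∈ Set.Ico 0 (2 * π), ∃ w₂ ∈ Set.Ico 0 (2 * π), ∃ w₃ ∈ Set.Ico 0 (2 * π),
      ∃ s₃ ∈ Set.Ico 0 (2 * π),
        fReal K (w₃, s₃) (fReal K (w₂, s₂) (fReal K (w₁, s₁) x)) = (X.1, X.2 - 2 * π) ∧
        fReal K (w₃, s₃) (fReal K (w₂, s₂) (fReal K (w₁, s₁) y)) = (Y.1, Y.2 - 2 * π) := by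
  obtain ⟨hs₁l, hs₁u⟩ := hs₁
  obtain ⟨hs₂l, hs₂u⟩ := hs₂
  simp only [abs_le] at hx₁ hx₂ hy₁ hy₂ hX₁ hX₂ hY₁ hY₂
  obtain ⟨β₀, hβ₀⟩ : ∃ β₀, β₀ = y.2 - x.2 - π := ⟨_, rfl⟩
  obtain ⟨β', hβ'⟩ : ∃ β', β' = β₀ - (y.1 - x.1) := ⟨_, rfl⟩
  obtain ⟨β₂, hβ₂⟩ : ∃ β₂, β₂ = Y.2 - X.2 - (Y.1 - X.1) - π := ⟨_, rfl⟩
  obtain ⟨β₃, hβ₃⟩ : ∃ β₃, β₃ = Y.2 - X.2 - π := ⟨_, rfl⟩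
  have hb₀ : |β₀| ≤ 2 * r := abs_le.2 ⟨by linarith, by linarith⟩
  have hb' : |β'| ≤ 4 * r := abs_le.2 ⟨by linarith, by linarith⟩
  have hb₂ : |β₂| ≤ 4 * r := abs_le.2 ⟨by linarith, by linarith⟩
  have hb₃ : |β₃| ≤ 2 * r := abs_le.2 ⟨by linarith, by linarith⟩
  obtain ⟨β, hb, hE⟩ := exists_meanKick_sum_eq (β₃ := β₃) (e := (x.1 + y.1) / 2)
    (E := (X.1 + Y.1) / 2) hK hη0 hη hηK hr hrK hb' hb₀ hb₂
    (abs_le.2 ⟨by linarith, by linarith⟩) (abs_le.2 ⟨by linarith, by linarith⟩)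
  have hm₁ : |meanKick K β₀ (β - 2 * β₀ + β')| ≤ K * (η / 100) := (abs_meanKick_le hK).trans
    (mul_le_mul_of_nonneg_left (by linarith) hK.le)
  have hm₂ : |meanKick K β (β₂ - 2 * β + β₀)| ≤ K * (η / 2) := (abs_meanKick_le hK).trans
    (mul_le_mul_of_nonneg_left (by linarith) hK.le)
  rw [abs_le] at hb₀ hb' hb₂ hb₃ hb hm₁ hm₂
  set m₁ := meanKick K β₀ (β - 2 * β₀ + β') with hm₁def
  set m₂ := meanKick K β (β₂ - 2 * β + β₀) with hm₂def
  set m₃ := meanKick K β₂ (β₃ - 2 * β₂ + β) with hm₃def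
  obtain ⟨κ₁, hκ₁⟩ : ∃ κ, κ = β - 2 * β₀ + β' := ⟨_, rfl⟩
  obtain ⟨κ₂, hκ₂⟩ : ∃ κ, κ = β₂ - 2 * β + β₀ := ⟨_, rfl⟩
  obtain ⟨κ₃, hκ₃⟩ : ∃ κ, κ = β₃ - 2 * β₂ + β := ⟨_, rfl⟩
  rw [← hκ₁] at hm₁def
  rw [← hκ₂] at hm₂def
  rw [← hκ₃] at hm₃def
  have hpi3 := Real.pi_gt_three
  have hpi4 := Real.pi_lt_d2
  obtain ⟨w₁, hw₁l, hw₁u, hw₁⟩ := exists_phase_of_kick (x := x) (y := y) (β := β₀) (κ := κ₁) hK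
    (by linarith) (abs_le.2 ⟨by linarith, by linarith⟩) (abs_le.2 ⟨by linarith, by linarith⟩)
  obtain ⟨hp₁, hq₁⟩ := hw₁ s₁
  have hp₂ := fReal_snd K (w₁, s₁) x
  have hq₂ := fReal_snd K (w₁, s₁) y
  rw [← hm₁def] at hp₁ hq₁
  set p := fReal K (w₁, s₁) x with hp
  set q := fReal K (w₁, s₁) y with hq
  simp only at hp₂ hq₂
  obtain ⟨w₂, hw₂l, hw₂u, hw₂⟩ := exists_phase_of_kick (x := p) (y := q) (β := β) (κ := κ₂) hK
    (by linarith) (abs_le.2 ⟨by linarith, by linarith⟩) (abs_le.2 ⟨by linarith, by linarith⟩)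
  obtain ⟨hu₁, hv₁⟩ := hw₂ s₂
  have hu₂ := fReal_snd K (w₂, s₂) p
  have hv₂ := fReal_snd K (w₂, s₂) q
  rw [← hm₂def] at hu₁ hv₁
  set u := fReal K (w₂, s₂) p with hu
  set v := fReal K (w₂, s₂) q with hv
  simp only at hu₂ hv₂
  obtain ⟨w₃, hw₃l, hw₃u, hw₃⟩ := exists_phase_of_kick (x := u) (y := v) (β := β₂) (κ := κ₃) hK
    (by linarith) (abs_le.2 ⟨by linarith, by linarith⟩) (abs_le.2 ⟨by linarith, by linarith⟩)
  obtain ⟨ha₁, hb₁⟩ := hw₃ (u.2 + X.1 - X.2 + 2 * π)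
  have ha₂ := fReal_snd K (w₃, u.2 + X.1 - X.2 + 2 * π) u
  have hb₂' := fReal_snd K (w₃, u.2 + X.1 - X.2 + 2 * π) v
  rw [← hm₃def] at ha₁ hb₁
  simp only at ha₂ hb₂'
  refine ⟨w₁, ⟨by linarith, by linarith⟩, w₂, ⟨by linarith, by linarith⟩, w₃,
    ⟨by linarith, by linarith⟩, u.2 + X.1 - X.2 + 2 * π, ⟨by linarith, by linarith⟩,
    Prod.ext ?_ ?_, Prod.ext ?_ ?_⟩ <;> linarith

/-! ### Density bound for three steps -/

/-- A Lipschitz self-map of a finite-dimensional space enlarges volumes at most by the power of its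
Lipschitz constant: this holds for Hausdorff measure, hence for every Haar measure. -/
theorem addHaar_image_le_of_lipschitzWith {E : Type*} [NormedAddCommGroup E] [NormedSpace ℝ E]
    [FiniteDimensional ℝ E] [MeasurableSpace E] [BorelSpace E] (μ : Measure E)
    [μ.IsAddHaarMeasure] {C : NNReal} {g : E → E} (hg : LipschitzWith C g) (s : Set E) :
    μ (g '' s) ≤ (C : ℝ≥0∞) ^ Module.finrank ℝ E * μ s := by
  have h := (hg.lipschitzOnWith (s := s)).hausdorffMeasure_image_le
    (d := (Module.finrank ℝ E : ℝ)) (Nat.cast_nonneg _)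
  rw [ENNReal.rpow_natCast] at h
  rw [Measure.isAddLeftInvariant_eq_smul μ (Measure.hausdorffMeasure (Module.finrank ℝ E : ℝ)),
    Measure.smul_apply, Measure.smul_apply, ENNReal.smul_def, ENNReal.smul_def, smul_eq_mul,
    smul_eq_mul, mul_left_comm]
  gcongr

/-- The covering map `ℝ⁴ → 𝕋² × 𝕋²`. -/
def toTorus₂ (t : (ℝ × ℝ) × (ℝ × ℝ)) : Torus × Torus := (toTorus t.1, toTorus t.2)

/-- The closed cube of half-side `r` about the lift `((0, 0), (0, π))` of `zStar`. -/
def liftBox (r : ℝ) : Set ((ℝ × ℝ) × (ℝ × ℝ)) :=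
  {t | |t.1.1| ≤ r ∧ |t.1.2| ≤ r ∧ |t.2.1| ≤ r ∧ |t.2.2 - π| ≤ r}

theorem phaseLaw_eq_smul : phaseLaw = ENNReal.ofReal ((2 * π) ^ 2)⁻¹ •
    (volume : Measure (ℝ × ℝ)).restrict (Set.Ico 0 (2 * π) ×ˢ Set.Ico 0 (2 * π)) := by
  rw [phaseLaw, ProbabilityTheory.cond, Measure.volume_eq_prod, Measure.prod_prod,
    Real.volume_Ico, sub_zero, ← ENNReal.ofReal_mul (by positivity), ← pow_two,
    ENNReal.ofReal_inv_of_pos (by positivity)]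

instance : IsProbabilityMeasure phaseLaw := by
  refine ProbabilityTheory.cond_isProbabilityMeasure_of_finite ?_ ?_ <;>
  rw [Measure.volume_eq_prod, Measure.prod_prod, Real.volume_Ico, sub_zero]
  · have : ENNReal.ofReal (2 * π) ≠ 0 := by
      rw [ne_eq, ENNReal.ofReal_eq_zero, not_le]
      positivity
    exact mul_ne_zero this this
  · exact ENNReal.mul_ne_top ENNReal.ofReal_ne_top ENNReal.ofReal_ne_top

instance (n : ℕ) : IsProbabilityMeasure (phasesLaw n) := by
  unfold phasesLaw
  infer_instance

theorem iter_three (K : ℝ) (ω : Fin 3 → ℝ × ℝ) (x : Torus) :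
    iter K 3 ω x = f K (ω 2) (f K (ω 1) (f K (ω 0) x)) := rfl

/-- Three steps of the lifted map; the entries of `p` are the last, the first and the second phase,
which is the order in which `MeasurableEquiv.piFinSuccAbove` splits `Fin 3 → ℝ × ℝ`. -/
def threeSteps (K : ℝ) (p : (ℝ × ℝ) × (ℝ × ℝ) × (ℝ × ℝ)) (x : ℝ × ℝ) : ℝ × ℝ :=
  fReal K p.1 (fReal K p.2.2 (fReal K p.2.1 x))

theorem dist_threeSteps_le {K : ℝ} (hK : 0 ≤ K) (p q : (ℝ × ℝ) × (ℝ × ℝ) × (ℝ × ℝ)) (x : ℝ × ℝ) :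
    dist (threeSteps K p x) (threeSteps K q x) ≤ (3 + 2 * K) ^ 3 * dist p q := by
  have h1 : dist p.1 q.1 ≤ dist p q := le_max_left _ _
  have h2 : dist p.2.1 q.2.1 ≤ dist p q := le_max_of_le_right (le_max_left _ _)
  have h3 : dist p.2.2 q.2.2 ≤ dist p q := le_max_of_le_right (le_max_right _ _)
  have hd : 0 ≤ dist p q := dist_nonneg
  have hL : 1 ≤ 3 + 2 * K := by linarith
  have e1 : dist p q ≤ (3 + 2 * K) * dist p q := le_mul_of_one_le_left hd hL
  have e2 : (3 + 2 * K) * dist p q ≤ (3 + 2 * K) * ((3 + 2 * K) * dist p q) :=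
    le_mul_of_one_le_left (by positivity) hL
  refine (dist_fReal_fReal_le hK (h1.trans (e1.trans e2)) (dist_fReal_fReal_le hK (h3.trans e1)
    (dist_fReal_fReal_le hK h2 (by rwa [dist_self])))).trans_eq ?_
  ring

/-- The map from the three phases to the second entries of the first two phases and the two end
points, as a self-map of `ℝ⁶`. -/
def phasesToEnds (K : ℝ) (x y : ℝ × ℝ) (p : (ℝ × ℝ) × (ℝ × ℝ) × (ℝ × ℝ)) :
    (ℝ × ℝ) × (ℝ × ℝ) × (ℝ × ℝ) :=
  ((p.2.1.2, p.2.2.2), threeSteps K p x + (0, 2 * π), threeSteps K p y + (0, 2 * π))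

theorem lipschitzWith_phasesToEnds {K : ℝ} (hK : 0 ≤ K) (x y : ℝ × ℝ) :
    LipschitzWith ((3 + 2 * K) ^ 3).toNNReal (phasesToEnds K x y) := by
  refine LipschitzWith.of_dist_le' fun p q => ?_
  have hL : dist p q ≤ (3 + 2 * K) ^ 3 * dist p q :=
    le_mul_of_one_le_left dist_nonneg (one_le_pow₀ (by linarith))
  have h2 : dist p.2.1.2 q.2.1.2 ≤ dist p q :=
    le_max_of_le_right (le_max_of_le_left (le_max_right _ _))
  have h3 : dist p.2.2.2 q.2.2.2 ≤ dist p q :=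
    le_max_of_le_right (le_max_of_le_right (le_max_right _ _))
  refine max_le (max_le (h2.trans hL) (h3.trans hL)) (max_le ?_ ?_) <;>
  · simp only [phasesToEnds, dist_add_right]
    exact dist_threeSteps_le hK _ _ _

theorem P2_three_apply (K : ℝ) (z : TwoPt) {A : Set TwoPt} (hA : MeasurableSet A) :
    P2 K 3 z A = (phaseLaw.prod (phaseLaw.prod phaseLaw))
      {p | Phi K 3 z ![p.2.1, p.2.2, p.1] ∈ A} := by
  have hm : MeasurePreserving (fun ω : Fin 3 → ℝ × ℝ => (ω 2, (ω 0, ω 1)))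
      (phasesLaw 3) (phaseLaw.prod (phaseLaw.prod phaseLaw)) :=
    ((MeasurePreserving.id phaseLaw).prod (measurePreserving_finTwoArrow phaseLaw)).comp
      (measurePreserving_piFinSuccAbove (fun _ : Fin 3 => phaseLaw) (Fin.last 2))
  have hmeas : MeasurableSet {p : (ℝ × ℝ) × (ℝ × ℝ) × (ℝ × ℝ) |
      Phi K 3 z ![p.2.1, p.2.2, p.1] ∈ A} := by
    refine (measurable_Phi K 3 z).comp (measurable_pi_lambda _ fun i => ?_) hA
    fin_cases i
    · exact measurable_snd.fst
    · exact measurable_snd.snd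
    · exact measurable_fst
  rw [P2_apply K 3 z hA, ← hm.measure_preimage hmeas.nullMeasurableSet]
  congr 1

theorem toTorus_sub_two_pi (X : ℝ × ℝ) : toTorus (X.1, X.2 - 2 * π) = toTorus X := by
  simp only [toTorus, AddCircle.coe_sub, AddCircle.coe_period, sub_zero]

/-- Three steps from a point near `zStar` have a density bounded below near `zStar`. Keeping the
second entries `s₁`, `s₂` of two phases as extra target coordinates makes the dimensions agree;
they range over a square of area `1 / 4`. -/
theorem ofReal_mul_volume_le_P2_three {K η r : ℝ} (hK : 0 < K) (hη0 : 0 ≤ η) (hη : η ≤ 1 / 20)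
    (hKη : K * η ≤ 1 / 20) (hηK : η ≤ K / 20) (hr : r ≤ η / 100) (hrK : r ≤ K * (η / 100))
    {z : TwoPt} {t : (ℝ × ℝ) × (ℝ × ℝ)} (ht : t ∈ liftBox r) (hz : toTorus₂ t = z.1)
    {A : Set TwoPt} (hA : MeasurableSet A) :
    ENNReal.ofReal (1 / 4 / (2 * π) ^ 6 / (3 + 2 * K) ^ 18) *
        volume {t' | t' ∈ liftBox r ∧ toTorus₂ t' ∈ Subtype.val '' A} ≤ P2 K 3 z A := by
  set N := {t' | t' ∈ liftBox r ∧ toTorus₂ t' ∈ Subtype.val '' A}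
  set I : Set (ℝ × ℝ) := Set.Ico 0 (2 * π) ×ˢ Set.Ico 0 (2 * π)
  set S : Set ((ℝ × ℝ) × (ℝ × ℝ) × (ℝ × ℝ)) := {p | Phi K 3 z ![p.2.1, p.2.2, p.1] ∈ A}
  have hP : P2 K 3 z A = ENNReal.ofReal (1 / (2 * π) ^ 6) * volume (S ∩ I ×ˢ I ×ˢ I) := by
    have hI : MeasurableSet I := measurableSet_Ico.prod measurableSet_Ico
    rw [P2_three_apply K z hA, phaseLaw_eq_smul]
    simp only [Measure.prod_smul_left, Measure.prod_smul_right, Measure.prod_restrict,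
      Measure.smul_apply, smul_eq_mul]
    rw [Measure.restrict_apply' (hI.prod (hI.prod hI)), ← mul_assoc, ← mul_assoc,
      ← ENNReal.ofReal_mul (by positivity), ← ENNReal.ofReal_mul (by positivity)]
    congr 2
    field_simp
  have hsub : (Set.Icc (1 / 2 : ℝ) 1 ×ˢ Set.Icc (1 / 2 : ℝ) 1) ×ˢ N ⊆
      phasesToEnds K t.1 t.2 '' (S ∩ I ×ˢ I ×ˢ I) := by
    rintro ⟨⟨s₁, s₂⟩, X, Y⟩ ⟨⟨hs₁, hs₂⟩, ⟨hX₁, hX₂, hY₁, hY₂⟩, ⟨w, hwA, hw⟩⟩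
    obtain ⟨hx₁, hx₂, hy₁, hy₂⟩ := ht
    obtain ⟨w₁, hw₁, w₂, hw₂, w₃, hw₃, s₃, hs₃, hX, hY⟩ := exists_three_phases hK hη0 hη hKη hηK
      hr hrK hx₁ hx₂ hy₁ hy₂ hX₁ hX₂ hY₁ hY₂ hs₁ hs₂
    have hs : Set.Icc (1 / 2 : ℝ) 1 ⊆ Set.Ico 0 (2 * π) := fun s hs =>
      ⟨by linarith [hs.1], by linarith [hs.2, Real.pi_gt_three]⟩
    refine ⟨((w₃, s₃), (w₁, s₁), (w₂, s₂)), ⟨?_, ⟨hw₃, hs₃⟩, ⟨hw₁, hs hs₁⟩, hw₂, hs hs₂⟩, ?_⟩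
    · have : Phi K 3 z ![(w₁, s₁), (w₂, s₂), (w₃, s₃)] = w := by
        refine Subtype.ext ?_
        rw [hw]
        simp only [Phi, iter_three, ← hz, toTorus₂]
        simp [f_toTorus, hX, hY, toTorus_sub_two_pi]
      simpa only [S, Set.mem_ofPred_eq, this] using hwA
    · simp [phasesToEnds, threeSteps, hX, hY]
  have hvol : ENNReal.ofReal (1 / 4) * volume N ≤
      ENNReal.ofReal ((3 + 2 * K) ^ 18) * volume (S ∩ I ×ˢ I ×ˢ I) := by
    have : (volume : Measure (ℝ × ℝ)).IsAddHaarMeasure := Measure.prod.instIsAddHaarMeasure _ _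
    have : (volume : Measure ((ℝ × ℝ) × (ℝ × ℝ))).IsAddHaarMeasure :=
      Measure.prod.instIsAddHaarMeasure _ _
    have : (volume : Measure ((ℝ × ℝ) × (ℝ × ℝ) × (ℝ × ℝ))).IsAddHaarMeasure :=
      Measure.prod.instIsAddHaarMeasure _ _
    have h := (measure_mono hsub).trans (addHaar_image_le_of_lipschitzWith volume
      (lipschitzWith_phasesToEnds hK.le t.1 t.2) _)
    have hfin : Module.finrank ℝ ((ℝ × ℝ) × (ℝ × ℝ) × (ℝ × ℝ)) = 6 := by simp
    rw [Measure.volume_eq_prod, Measure.prod_prod, Measure.volume_eq_prod ℝ ℝ, Measure.prod_prod,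
      Real.volume_Icc, ← ENNReal.ofReal_mul (by norm_num), hfin, ← Measure.volume_eq_prod,
      ENNReal.ofNNReal_toNNReal, ← ENNReal.ofReal_pow (by positivity), ← pow_mul] at h
    norm_num at h ⊢
    exact h
  rw [hP]
  have e1 : 1 / 4 / (2 * π) ^ 6 / (3 + 2 * K) ^ 18 =
      1 / (2 * π) ^ 6 * (1 / (3 + 2 * K) ^ 18) * (1 / 4) := by
    field_simp
  have e2 : 1 / (2 * π) ^ 6 * (1 / (3 + 2 * K) ^ 18) * (3 + 2 * K) ^ 18 = 1 / (2 * π) ^ 6 := by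
    field_simp
  rw [e1, ENNReal.ofReal_mul (by positivity), mul_assoc]
  refine (mul_le_mul_right hvol _).trans_eq ?_
  rw [← mul_assoc, ← ENNReal.ofReal_mul (by positivity), e2]

/-! ### Balls about `zStar` -/

theorem mem_ball_zStar_iff {z : TwoPt} {r : ℝ} (hr : 0 < r) : z ∈ ball zStar r ↔
    ‖z.1.1.1‖ ^ 2 + ‖z.1.1.2‖ ^ 2 + ‖z.1.2.1‖ ^ 2 + ‖z.1.2.2 - ((π : ℝ) : Circ)‖ ^ 2 < r ^ 2 := by
  simp only [ball, flatDist, zStar, Set.mem_ofPred_eq, dist_eq_norm, sub_zero]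
  rw [Real.sqrt_lt' hr]

theorem norm_lt_of_mem_ball_zStar {z : TwoPt} {r : ℝ} (hr : 0 < r) (hz : z ∈ ball zStar r) :
    ‖z.1.1.1‖ < r ∧ ‖z.1.1.2‖ < r ∧ ‖z.1.2.1‖ < r ∧ ‖z.1.2.2 - ((π : ℝ) : Circ)‖ < r := by
  rw [mem_ball_zStar_iff hr] at hz
  refine ⟨?_, ?_, ?_, ?_⟩ <;> refine lt_of_pow_lt_pow_left₀ 2 hr.le ?_ <;>
  linarith [sq_nonneg ‖z.1.1.1‖, sq_nonneg ‖z.1.1.2‖, sq_nonneg ‖z.1.2.1‖,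
    sq_nonneg ‖z.1.2.2 - ((π : ℝ) : Circ)‖]

theorem mem_ball_zStar_of_norm_le {z : TwoPt} {r : ℝ} (hr : 0 < r) (h₁ : ‖z.1.1.1‖ ≤ r / 3)
    (h₂ : ‖z.1.1.2‖ ≤ r / 3) (h₃ : ‖z.1.2.1‖ ≤ r / 3)
    (h₄ : ‖z.1.2.2 - ((π : ℝ) : Circ)‖ ≤ r / 3) : z ∈ ball zStar r := by
  rw [mem_ball_zStar_iff hr]
  have h : ∀ {a : ℝ}, 0 ≤ a → a ≤ r / 3 → a ^ 2 ≤ (r / 3) ^ 2 := fun h0 h => by gcongr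
  have := h (norm_nonneg _) h₁
  have := h (norm_nonneg _) h₂
  have := h (norm_nonneg _) h₃
  have := h (norm_nonneg _) h₄
  nlinarith

theorem exists_lift_of_mem_ball_zStar {z : TwoPt} {r : ℝ} (hr : 0 < r) (hz : z ∈ ball zStar r) :
    ∃ t ∈ liftBox r, toTorus₂ t = z.1 := by
  obtain ⟨h₁, h₂, h₃, h₄⟩ := norm_lt_of_mem_ball_zStar hr hz
  obtain ⟨a, ha, ha'⟩ := QuotientAddGroup.norm_lt_iff.1 h₁
  obtain ⟨b, hb, hb'⟩ := QuotientAddGroup.norm_lt_iff.1 h₂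
  obtain ⟨c, hc, hc'⟩ := QuotientAddGroup.norm_lt_iff.1 h₃
  obtain ⟨d, hd, hd'⟩ := QuotientAddGroup.norm_lt_iff.1 h₄
  refine ⟨((a, b), (c, d + π)), ⟨ha'.le, hb'.le, hc'.le, ?_⟩,
    Prod.ext (Prod.ext ha hb) (Prod.ext hc ?_)⟩
  · simpa using hd'.le
  · exact (AddCircle.coe_add _ _ _).trans (eq_sub_iff_add_eq.1 hd)

theorem norm_coe_circ_le_abs (t : ℝ) : ‖(t : Circ)‖ ≤ |t| :=
  QuotientAddGroup.norm_mk_le_norm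

theorem norm_coe_circ_eq_abs {t : ℝ} (ht : |t| ≤ π) : ‖(t : Circ)‖ = |t| := by
  refine (AddCircle.norm_coe_eq_abs_iff _ Real.two_pi_pos.ne').2 ?_
  rw [abs_of_pos Real.two_pi_pos]
  linarith

theorem mem_ball_zStar_of_lift {z : TwoPt} {r : ℝ} (hr : 0 < r) {t : (ℝ × ℝ) × (ℝ × ℝ)}
    (ht : t ∈ liftBox (r / 3)) (hz : toTorus₂ t = z.1) : z ∈ ball zStar r := by
  obtain ⟨h₁, h₂, h₃, h₄⟩ := ht
  apply mem_ball_zStar_of_norm_le hr <;> rw [← hz]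
  · exact (norm_coe_circ_le_abs _).trans h₁
  · exact (norm_coe_circ_le_abs _).trans h₂
  · exact (norm_coe_circ_le_abs _).trans h₃
  · refine le_trans ?_ h₄
    simp only [toTorus₂, toTorus]
    rw [← AddCircle.coe_sub]
    exact norm_coe_circ_le_abs _

theorem measurableSet_diagonal_compl :
    MeasurableSet {z : Torus × Torus | z.1 ≠ z.2} :=
  (isClosed_eq continuous_fst continuous_snd).isOpen_compl.measurableSet

theorem leb_apply (A : Set TwoPt) :
    leb A = (volume : Measure (Torus × Torus)) (Subtype.val '' A) :=
  (MeasurableEmbedding.subtype_coe measurableSet_diagonal_compl).comap_apply _ _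

theorem measurableSet_ball (z : TwoPt) (r : ℝ) : MeasurableSet (ball z r) := by
  refine (isOpen_lt ?_ continuous_const).measurableSet
  unfold flatDist
  fun_prop

theorem leb_inter_ball_le_volume {r : ℝ} (hr : 0 < r) {A : Set TwoPt} (hA : MeasurableSet A) :
    leb (A ∩ ball zStar r) ≤
      volume {t | t ∈ liftBox r ∧ toTorus₂ t ∈ Subtype.val '' A} := by
  have hm : ∀ a : ℝ, MeasurePreserving (fun t : ℝ => (t : Circ))
      (volume.restrict (Set.Ioc a (a + 2 * π))) volume :=
    fun a => AddCircle.measurePreserving_mk (2 * π) a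
  have hm₄ := ((hm (-π)).prod (hm (-π))).prod ((hm (-π)).prod (hm 0))
  have hAm : MeasurableSet (Subtype.val '' (A ∩ ball zStar r)) :=
    (MeasurableEmbedding.subtype_coe measurableSet_diagonal_compl).measurableSet_image.2
      (hA.inter (measurableSet_ball _ _))
  rw [leb_apply]
  simp only [Measure.volume_eq_prod]
  rw [← hm₄.measure_preimage hAm.nullMeasurableSet]
  simp only [Measure.prod_restrict]
  rw [Measure.restrict_apply' ((measurableSet_Ioc.prod measurableSet_Ioc).prod
    (measurableSet_Ioc.prod measurableSet_Ioc))]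
  refine measure_mono ?_
  rintro ⟨⟨a, b⟩, c, d⟩ ⟨⟨w, ⟨hwA, hw⟩, hwt⟩, ⟨ha, hb⟩, hc, hd⟩
  refine ⟨?_, w, hwA, hwt⟩
  obtain ⟨h₁, h₂, h₃, h₄⟩ := norm_lt_of_mem_ball_zStar hr hw
  rw [hwt] at h₁ h₂ h₃ h₄
  have habs : ∀ {t : ℝ}, t ∈ Set.Ioc (-π) (-π + 2 * π) → ‖(t : Circ)‖ < r → |t| ≤ r :=
    fun ht h => (norm_coe_circ_eq_abs (abs_le.2 ⟨ht.1.le, by linarith [ht.2]⟩)).symm.trans_le h.le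
  refine ⟨habs ha h₁, habs hb h₂, habs hc h₃, ?_⟩
  simp only [Prod.map] at h₄
  rw [← AddCircle.coe_sub] at h₄
  exact habs ⟨by linarith [hd.1], by linarith [hd.2]⟩ h₄

theorem ofReal_le_leb_ball {r : ℝ} (hr : 0 < r) (hr1 : r ≤ 1) :
    ENNReal.ofReal ((r / 2) ^ 4) ≤ leb (ball zStar r) := by
  have hsub : (Metric.closedBall (0 : Circ) (r / 3) ×ˢ Metric.closedBall (0 : Circ) (r / 3)) ×ˢ
      (Metric.closedBall (0 : Circ) (r / 3) ×ˢ Metric.closedBall ((π : ℝ) : Circ) (r / 3)) ⊆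
      Subtype.val '' ball zStar r := by
    rintro ⟨⟨a, b⟩, c, d⟩ ⟨⟨ha, hb⟩, hc, hd⟩
    simp only [Metric.mem_closedBall, dist_eq_norm, sub_zero] at ha hb hc hd
    have hne : ((a, b) : Torus) ≠ (c, d) := by
      intro h
      have hbd : b = d := congrArg Prod.snd h
      have hpi : ‖((π : ℝ) : Circ)‖ ≤ ‖b‖ + ‖d - ((π : ℝ) : Circ)‖ := by
        rw [← hbd]
        simpa using norm_sub_le b (b - ((π : ℝ) : Circ))
      rw [norm_coe_circ_eq_abs (abs_of_pos pi_pos).le, abs_of_pos pi_pos] at hpi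
      linarith [Real.pi_gt_three]
    exact ⟨⟨((a, b), (c, d)), hne⟩, mem_ball_zStar_of_norm_le hr ha hb hc hd, rfl⟩
  have hmin : min (2 * π) (2 * (r / 3)) = 2 * (r / 3) :=
    min_eq_right (by linarith [Real.pi_gt_three])
  rw [leb_apply]
  refine le_trans ?_ (measure_mono hsub)
  simp only [Measure.volume_eq_prod, Measure.prod_prod, AddCircle.volume_closedBall, hmin]
  rw [← ENNReal.ofReal_mul (by positivity), ← ENNReal.ofReal_mul (by positivity)]
  refine ENNReal.ofReal_le_ofReal ?_
  calc (r / 2) ^ 4 ≤ (2 * (r / 3)) ^ 4 := by gcongr; linarith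
    _ = _ := by ring

/-! ### Composition of transition kernels -/

theorem iter_add (K : ℝ) (n : ℕ) (x : Torus) : ∀ (m : ℕ) (ω : Fin (n + m) → ℝ × ℝ),
    iter K (n + m) ω x = iter K m (fun i => ω (Fin.natAdd n i))
      (iter K n (fun i => ω (Fin.castAdd m i)) x)
  | 0, _ => rfl
  | m + 1, ω => congrArg (f K (ω (Fin.last (n + m)))) (iter_add K n x m (Fin.init ω))

theorem Phi_add (K : ℝ) (n m : ℕ) (z : TwoPt) (ω : Fin (n + m) → ℝ × ℝ) :
    Phi K (n + m) z ω = Phi K m (Phi K n z fun i => ω (Fin.castAdd m i))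
      (fun i => ω (Fin.natAdd n i)) :=
  Subtype.ext (Prod.ext (iter_add K n z.1.1 m ω) (iter_add K n z.1.2 m ω))

/-- The joint law of `n + m` phases is the product of the laws of the first `n` and of the
last `m`. -/
theorem measurePreserving_split_phases (n m : ℕ) :
    ∃ e : (Fin (n + m) → ℝ × ℝ) ≃ᵐ (Fin n → ℝ × ℝ) × (Fin m → ℝ × ℝ),
      MeasurePreserving e (phasesLaw (n + m)) ((phasesLaw n).prod (phasesLaw m)) ∧
      ∀ ω, e ω = (fun i => ω (Fin.castAdd m i), fun i => ω (Fin.natAdd n i)) := by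
  have h1 := (measurePreserving_piCongrLeft (fun _ : Fin (n + m) => phaseLaw)
    (finSumFinEquiv (m := n) (n := m))).symm
  have h2 := measurePreserving_sumPiEquivProdPi (fun _ : Fin n ⊕ Fin m => phaseLaw)
  exact ⟨(MeasurableEquiv.piCongrLeft _ finSumFinEquiv).symm.trans
    (MeasurableEquiv.sumPiEquivProdPi _), h2.comp h1, fun ω => rfl⟩

/-- A one-sided Chapman–Kolmogorov inequality: restrict to the trajectories that are in `V` at
time `n`. -/
theorem mul_P2_le_P2_add {K : ℝ} {n m : ℕ} {z : TwoPt} {V A : Set TwoPt}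
    (hV : MeasurableSet V) (hA : MeasurableSet A) {c : ℝ≥0∞} (hc : ∀ w ∈ V, c ≤ P2 K m w A) :
    c * P2 K n z V ≤ P2 K (n + m) z A := by
  obtain ⟨e, he, heω⟩ := measurePreserving_split_phases n m
  have hS : MeasurableSet {ω | Phi K (n + m) z ω ∈ A} := measurable_Phi K (n + m) z hA
  have hpre : e ⁻¹' {p | Phi K m (Phi K n z p.1) p.2 ∈ A} = {ω | Phi K (n + m) z ω ∈ A} := by
    ext ω
    simp [Phi_add, heω]
  have hS' : MeasurableSet {p : (Fin n → ℝ × ℝ) × (Fin m → ℝ × ℝ) |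
      Phi K m (Phi K n z p.1) p.2 ∈ A} := by
    rwa [← e.measurableSet_preimage, hpre]
  rw [P2_apply K (n + m) z hA, ← hpre, he.measure_preimage hS'.nullMeasurableSet,
    Measure.prod_apply hS', P2_apply K n z hV]
  have hVm : MeasurableSet {ω | Phi K n z ω ∈ V} := measurable_Phi K n z hV
  calc c * phasesLaw n {ω | Phi K n z ω ∈ V}
      = ∫⁻ _ in {ω | Phi K n z ω ∈ V}, c ∂phasesLaw n := by rw [setLIntegral_const]
    _ ≤ ∫⁻ ω in {ω | Phi K n z ω ∈ V},
          phasesLaw m (Prod.mk ω ⁻¹' {p | Phi K m (Phi K n z p.1) p.2 ∈ A}) ∂phasesLaw n := by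
        refine setLIntegral_mono' hVm fun ω hω => ?_
        exact (hc _ hω).trans_eq (P2_apply K m _ hA)
    _ ≤ _ := setLIntegral_le_lintegral _ _

/-! ### Staying near `zStar` for a few steps -/

theorem exists_lift_iter_dist_le {K : ℝ} (hK : 0 ≤ K) {p t : ℝ × ℝ} (hp : fReal K 0 p = p)
    {ε : ℝ} (ht : dist t p ≤ ε) : ∀ (n : ℕ) (ω : Fin n → ℝ × ℝ), (∀ i, dist (ω i) 0 ≤ ε) →
      ∃ t', dist t' p ≤ (3 + 2 * K) ^ n * ε ∧ toTorus t' = iter K n ω (toTorus t)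
  | 0, _, _ => ⟨t, by simpa using ht, rfl⟩
  | n + 1, ω, hω => by
    obtain ⟨t', ht', hit⟩ := exists_lift_iter_dist_le hK hp ht n (Fin.init ω) fun i => hω _
    have hε : 0 ≤ ε := dist_nonneg.trans ht
    have hle : ε ≤ (3 + 2 * K) ^ n * ε :=
      le_mul_of_one_le_left hε (one_le_pow₀ (by linarith))
    refine ⟨fReal K (ω (Fin.last n)) t', ?_, ?_⟩
    · have h := dist_fReal_fReal_le hK ((hω (Fin.last n)).trans hle) ht'
      rw [hp] at h
      exact h.trans_eq (by ring)
    · rw [← f_toTorus, hit]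
      rfl

theorem fReal_zero_of_sin_eq_zero (K : ℝ) {y : ℝ} (hy : sin y = 0) : fReal K 0 (0, y) = (0, y) := by
  simp [fReal, hy]

theorem mem_liftBox_iff {r : ℝ} {t : (ℝ × ℝ) × (ℝ × ℝ)} :
    t ∈ liftBox r ↔ dist t.1 (0, 0) ≤ r ∧ dist t.2 (0, π) ≤ r := by
  simp [liftBox, Prod.dist_eq, Real.dist_eq, and_assoc]

/-- With phases in `[0, ε)²` the two points stay close to `zStar`, which is fixed under the zero
phase. -/
theorem ofReal_pow_le_P2_ball {K ε r : ℝ} (hK : 0 ≤ K) (hε : 0 < ε) (hε1 : ε ≤ 1) {n : ℕ}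
    (hr : (3 + 2 * K) ^ n * ε ≤ r / 3) {z : TwoPt} {t : (ℝ × ℝ) × (ℝ × ℝ)}
    (ht : t ∈ liftBox ε) (hz : toTorus₂ t = z.1) :
    ENNReal.ofReal ((ε / (2 * π)) ^ 2) ^ n ≤ P2 K n z (ball zStar r) := by
  have hr0 : 0 < r := by
    have : 0 < (3 + 2 * K) ^ n * ε := by positivity
    linarith
  have hsub : Set.univ.pi (fun _ : Fin n => Set.Ico 0 ε ×ˢ Set.Ico 0 ε) ⊆
      {ω | Phi K n z ω ∈ ball zStar r} := by
    intro ω hω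
    have hω' : ∀ i, dist (ω i) 0 ≤ ε := fun i => by
      obtain ⟨h1, h2⟩ := hω i (Set.mem_univ i)
      simp only [Prod.dist_eq, Real.dist_eq, Prod.fst_zero, Prod.snd_zero, sub_zero]
      rw [abs_of_nonneg h1.1, abs_of_nonneg h2.1]
      exact max_le h1.2.le h2.2.le
    obtain ⟨ht₁, ht₂⟩ := mem_liftBox_iff.1 ht
    obtain ⟨a, ha, ha'⟩ := exists_lift_iter_dist_le hK
      (fReal_zero_of_sin_eq_zero K Real.sin_zero) ht₁ n ω hω'
    obtain ⟨b, hb, hb'⟩ := exists_lift_iter_dist_le hK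
      (fReal_zero_of_sin_eq_zero K Real.sin_pi) ht₂ n ω hω'
    refine mem_ball_zStar_of_lift hr0 (t := (a, b))
      (mem_liftBox_iff.2 ⟨ha.trans hr, hb.trans hr⟩) ?_
    simp only [Phi, ← hz, toTorus₂, ha', hb']
  rw [P2_apply K n z (measurableSet_ball _ _)]
  refine le_trans (le_of_eq ?_) (measure_mono hsub)
  have hI : Set.Ico 0 ε ×ˢ Set.Ico 0 ε ⊆
      Set.Ico (0 : ℝ) (2 * π) ×ˢ Set.Ico (0 : ℝ) (2 * π) := by
    have h : Set.Ico 0 ε ⊆ Set.Ico (0 : ℝ) (2 * π) :=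
      Set.Ico_subset_Ico le_rfl (by linarith [Real.pi_gt_three])
    exact Set.prod_mono h h
  rw [phasesLaw, Measure.pi_pi, Finset.prod_const, Finset.card_univ, Fintype.card_fin,
    phaseLaw_eq_smul, Measure.smul_apply,
    Measure.restrict_apply (measurableSet_Ico.prod measurableSet_Ico),
    Set.inter_eq_left.2 hI, Measure.volume_eq_prod, Measure.prod_prod, Real.volume_Ico, sub_zero,
    smul_eq_mul, ← ENNReal.ofReal_mul hε.le, ← ENNReal.ofReal_mul (by positivity)]
  congr 2
  field_simp

/-! ### Iteration and the choice of constants -/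

/-- One to four steps keep the process near `zStar` with probability at least
`(ε / 2π) ^ 8`, and three further steps have a density: this covers four to seven steps. -/
theorem mul_leb_le_P2_of_lt {K η r ε : ℝ} (hK : 0 < K) (hη0 : 0 ≤ η) (hη : η ≤ 1 / 20)
    (hKη : K * η ≤ 1 / 20) (hηK : η ≤ K / 20) (hr : r ≤ η / 100) (hrK : r ≤ K * (η / 100))
    (hε : 0 < ε) (hεr : (3 + 2 * K) ^ 4 * ε ≤ r / 3) {s : ℕ} (hs : s < 4) {z : TwoPt}
    (hz : z ∈ ball zStar ε) {A : Set TwoPt} (hA : MeasurableSet A) :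
    ENNReal.ofReal ((ε / (2 * π)) ^ 8 * (1 / 4 / (2 * π) ^ 6 / (3 + 2 * K) ^ 18)) *
      leb (A ∩ ball zStar r) ≤ P2 K (4 + s) z A := by
  have hL : 1 ≤ 3 + 2 * K := by linarith
  have hε1 : ε ≤ 1 := by
    have : ε ≤ (3 + 2 * K) ^ 4 * ε := le_mul_of_one_le_left hε.le (one_le_pow₀ hL)
    linarith
  have hr0 : 0 < r := by
    have : 0 < (3 + 2 * K) ^ 4 * ε := by positivity
    linarith
  have h3 : ∀ w ∈ ball zStar r, ENNReal.ofReal (1 / 4 / (2 * π) ^ 6 / (3 + 2 * K) ^ 18) *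
      leb (A ∩ ball zStar r) ≤ P2 K 3 w A := by
    intro w hw
    obtain ⟨t, ht, htw⟩ := exists_lift_of_mem_ball_zStar hr0 hw
    refine le_trans ?_ (ofReal_mul_volume_le_P2_three hK hη0 hη hKη hηK hr hrK ht htw hA)
    gcongr
    exact leb_inter_ball_le_volume hr0 hA
  obtain ⟨t, ht, htz⟩ := exists_lift_of_mem_ball_zStar hε hz
  have hpow : (3 + 2 * K) ^ (s + 1) * ε ≤ r / 3 :=
    (mul_le_mul_of_nonneg_right (pow_le_pow_right₀ hL (by omega)) hε.le).trans hεr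
  have hp : (ε / (2 * π)) ^ 2 ≤ 1 := by
    refine pow_le_one₀ (by positivity) ?_
    rw [div_le_one (by positivity)]
    linarith [Real.pi_gt_three]
  have h1 : ENNReal.ofReal ((ε / (2 * π)) ^ 8) ≤ P2 K (s + 1) z (ball zStar r) := by
    refine le_trans ?_ (ofReal_pow_le_P2_ball hK.le hε hε1 hpow ht htz)
    rw [← ENNReal.ofReal_pow (by positivity)]
    refine ENNReal.ofReal_le_ofReal ?_
    calc (ε / (2 * π)) ^ 8 = ((ε / (2 * π)) ^ 2) ^ 4 := by ring
      _ ≤ ((ε / (2 * π)) ^ 2) ^ (s + 1) := pow_le_pow_of_le_one (by positivity) hp (by omega)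
  have h := mul_P2_le_P2_add (n := s + 1) (m := 3) (z := z) (measurableSet_ball _ _) hA h3
  rw [show 4 + s = s + 1 + 3 by ring]
  refine le_trans ?_ h
  rw [ENNReal.ofReal_mul (by positivity), mul_assoc, mul_comm]
  gcongr

/-- Each additional block of four steps costs the probability of returning to the small ball. -/
theorem pow_mul_leb_le_P2 {K η r ε : ℝ} (hK : 0 < K) (hη0 : 0 ≤ η) (hη : η ≤ 1 / 20)
    (hKη : K * η ≤ 1 / 20) (hηK : η ≤ K / 20) (hr : r ≤ η / 100) (hrK : r ≤ K * (η / 100))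
    (hε : 0 < ε) (hεr : (3 + 2 * K) ^ 4 * ε ≤ r / 3) {a : ℝ}
    (ha : a = (ε / (2 * π)) ^ 8 * (1 / 4 / (2 * π) ^ 6 / (3 + 2 * K) ^ 18))
    {A : Set TwoPt} (hA : MeasurableSet A) {s : ℕ} (hs : s < 4) :
    ∀ (q : ℕ), ∀ z ∈ ball zStar ε, ENNReal.ofReal ((a * (ε / 2) ^ 4) ^ q * a) *
      leb (A ∩ ball zStar r) ≤ P2 K (4 * q + (4 + s)) z A
  | 0, z, hz => by
    have h := mul_leb_le_P2_of_lt hK hη0 hη hKη hηK hr hrK hε hεr hs hz hA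
    rw [← ha] at h
    simpa using h
  | q + 1, z, hz => by
    have ha0 : 0 ≤ a := by
      rw [ha]
      positivity
    have hεle : ε ≤ (3 + 2 * K) ^ 4 * ε :=
      le_mul_of_one_le_left hε.le (one_le_pow₀ (by linarith))
    have hUV : ball zStar ε ∩ ball zStar r = ball zStar ε :=
      Set.inter_eq_left.2 fun w (hw : flatDist _ _ < ε) =>
        show flatDist _ _ < r from hw.trans_le (by linarith)
    have hret : ENNReal.ofReal (a * (ε / 2) ^ 4) ≤ P2 K 4 z (ball zStar ε) := by
      have h := mul_leb_le_P2_of_lt hK hη0 hη hKη hηK hr hrK hε hεr (s := 0) (by norm_num) hz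
        (measurableSet_ball zStar ε)
      rw [← ha, hUV] at h
      refine le_trans ?_ h
      rw [ENNReal.ofReal_mul ha0]
      gcongr
      exact ofReal_le_leb_ball hε (by linarith)
    have h := mul_P2_le_P2_add (n := 4) (measurableSet_ball zStar ε) hA (z := z)
      (pow_mul_leb_le_P2 hK hη0 hη hKη hηK hr hrK hε hεr ha hA hs q)
    rw [show 4 * (q + 1) + (4 + s) = 4 + (4 * q + (4 + s)) by ring]
    refine le_trans ?_ h
    rw [pow_succ', mul_assoc (a * (ε / 2) ^ 4), ENNReal.ofReal_mul (by positivity), mul_assoc,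
      mul_comm]
    gcongr

theorem pow_mul_zpow_neg_le {k K : ℝ} (hk : 0 < k) (hkK : k ≤ K) (p m : ℕ) :
    k ^ p * K ^ (-((p + m : ℕ) : ℤ)) ≤ (K ^ m)⁻¹ := by
  have hK : 0 < K := hk.trans_le hkK
  rw [zpow_neg, zpow_natCast, pow_add, mul_inv, ← mul_assoc]
  refine mul_le_of_le_one_left (by positivity) ?_
  rw [← div_eq_mul_inv, div_le_one (by positivity)]
  gcongr

end

end RandomChirikov

theorem mainTheorem6 :
    ∀ K₀ : ℝ, 0 < K₀ →
      ∃ C₁ C₂ C₃ C₄ : ℝ, 0 < C₁ ∧ 0 < C₂ ∧ 0 < C₃ ∧ 0 < C₄ ∧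
        ∀ K : ℝ, K₀ ≤ K → ∀ n : ℕ, 4 ≤ n →
          ∀ z ∈ RandomChirikov.ball RandomChirikov.zStar (C₁ * K ^ (-130 : ℤ)),
            ENNReal.ofReal ((C₃ * K ^ (-764 : ℤ)) ^ (n / 4 - 1) * (C₂ * K ^ (-780 : ℤ))) •
                (ENNReal.ofReal (K ^ (-288 : ℤ)) •
                  RandomChirikov.leb.restrict
                    (RandomChirikov.ball RandomChirikov.zStar (C₄ * K ^ (-55 : ℤ)))) ≤
              RandomChirikov.P2 K n z := by
  intro K₀ hK₀
  obtain ⟨k, hk0, hk1, hkK₀⟩ : ∃ k : ℝ, 0 < k ∧ k ≤ 1 ∧ k ≤ K₀ :=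
    ⟨min K₀ 1, lt_min hK₀ one_pos, min_le_right _ _, min_le_left _ _⟩
  obtain ⟨M, hM0, hM⟩ : ∃ M : ℝ, 0 < M ∧ ∀ K, k ≤ K → 3 + 2 * K ≤ M * K := by
    refine ⟨2 + 3 / k, by positivity, fun K hK => ?_⟩
    have : 3 / k * k ≤ 3 / k * K := mul_le_mul_of_nonneg_left hK (by positivity)
    rw [div_mul_cancel₀ _ hk0.ne'] at this
    linarith
  -- The radii `ρ / K` and `σ / K ^ 5` are those of the balls in which three steps have a density
  -- and in which four steps do not leave the first ball.
  obtain ⟨ρ, hρ⟩ : ∃ ρ, ρ = k ^ 3 / 2000 := ⟨_, rfl⟩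
  obtain ⟨σ, hσ⟩ : ∃ σ, σ = ρ / (3 * M ^ 4) := ⟨_, rfl⟩
  obtain ⟨a₀, ha₀⟩ : ∃ a₀, a₀ = (σ / (2 * π)) ^ 8 * (1 / 4 / (2 * π) ^ 6 / M ^ 18) := ⟨_, rfl⟩
  have hρ0 : 0 < ρ := by rw [hρ]; positivity
  have hσ0 : 0 < σ := by rw [hσ]; positivity
  have ha₀0 : 0 < a₀ := by rw [ha₀]; positivity
  refine ⟨σ * k ^ 125, a₀ * k ^ 1010, a₀ * (σ / 2) ^ 4 * k ^ 686, ρ * k ^ 54, by positivity,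
    by positivity, by positivity, by positivity, fun K hK n hn z hz => ?_⟩
  have hkK : k ≤ K := hkK₀.trans hK
  have hK0 : 0 < K := hk0.trans_le hkK
  have hMK := hM K hkK
  have hball : ∀ {c : ℝ} {p m : ℕ}, 0 ≤ c → RandomChirikov.ball RandomChirikov.zStar
      (c * k ^ p * K ^ (-((p + m : ℕ) : ℤ))) ⊆
      RandomChirikov.ball RandomChirikov.zStar (c * (K ^ m)⁻¹) := by
    intro c p m hc w hw
    refine lt_of_lt_of_le (b := c * k ^ p * K ^ (-((p + m : ℕ) : ℤ))) hw ?_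
    rw [mul_assoc]
    exact mul_le_mul_of_nonneg_left (RandomChirikov.pow_mul_zpow_neg_le hk0 hkK p m) hc
  obtain ⟨a, ha⟩ : ∃ a, a = (σ * (K ^ 5)⁻¹ / (2 * π)) ^ 8 *
    (1 / 4 / (2 * π) ^ 6 / (3 + 2 * K) ^ 18) := ⟨_, rfl⟩
  have ha0 : 0 ≤ a := by
    rw [ha]
    positivity
  have ha_le : a₀ * (K ^ 58)⁻¹ ≤ a := by
    have : a₀ * (K ^ 58)⁻¹ = (σ * (K ^ 5)⁻¹ / (2 * π)) ^ 8 *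
        (1 / 4 / (2 * π) ^ 6 / (M * K) ^ 18) := by
      rw [ha₀]
      field_simp
    rw [this, ha]
    gcongr
  have hcoef : (a₀ * (σ / 2) ^ 4 * k ^ 686 * K ^ (-764 : ℤ)) ^ (n / 4 - 1) *
      (a₀ * k ^ 1010 * K ^ (-780 : ℤ)) * K ^ (-288 : ℤ) ≤
      (a * (σ * (K ^ 5)⁻¹ / 2) ^ 4) ^ (n / 4 - 1) * a := by
    have h1 : a₀ * (σ / 2) ^ 4 * k ^ 686 * K ^ (-764 : ℤ) ≤ a * (σ * (K ^ 5)⁻¹ / 2) ^ 4 := by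
      calc _ = a₀ * (σ / 2) ^ 4 * (k ^ 686 * K ^ (-((686 + 78 : ℕ) : ℤ))) := by
            rw [mul_assoc]; rfl
        _ ≤ a₀ * (σ / 2) ^ 4 * (K ^ 78)⁻¹ := mul_le_mul_of_nonneg_left
            (RandomChirikov.pow_mul_zpow_neg_le hk0 hkK _ _) (by positivity)
        _ = a₀ * (K ^ 58)⁻¹ * (σ * (K ^ 5)⁻¹ / 2) ^ 4 := by field_simp
        _ ≤ _ := by gcongr
    have h2 : a₀ * k ^ 1010 * K ^ (-780 : ℤ) * K ^ (-288 : ℤ) ≤ a := by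
      calc _ = a₀ * (k ^ 1010 * K ^ (-((1010 + 58 : ℕ) : ℤ))) := by
            rw [mul_assoc, ← zpow_add₀ hK0.ne', mul_assoc]; rfl
        _ ≤ a₀ * (K ^ 58)⁻¹ := mul_le_mul_of_nonneg_left
            (RandomChirikov.pow_mul_zpow_neg_le hk0 hkK _ _) ha₀0.le
        _ ≤ a := ha_le
    rw [mul_assoc]
    gcongr
  have hzU : z ∈ RandomChirikov.ball RandomChirikov.zStar (σ * (K ^ 5)⁻¹) :=
    hball (p := 125) (m := 5) hσ0.le hz
  have hsubV : RandomChirikov.ball RandomChirikov.zStar (ρ * k ^ 54 * K ^ (-55 : ℤ)) ⊆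
      RandomChirikov.ball RandomChirikov.zStar (ρ * (K ^ 1)⁻¹) :=
    hball (p := 54) (m := 1) hρ0.le
  -- The amplitude `η = k² / (20 K)` of the second-coordinate differences makes `K η` small, which
  -- keeps the lifted trajectories, and so the phases, away from the ends of the fundamental domain.
  refine Measure.le_intro fun A hA _ => ?_
  have hk2 : k ^ 2 ≤ k := by nlinarith
  have hηk : k ^ 2 / (20 * K) ≤ k / 20 := by
    rw [div_le_div_iff₀ (by positivity) (by norm_num)]
    nlinarith
  have hρη : ρ * (K ^ 1)⁻¹ = k * (k ^ 2 / (20 * K) / 100) := by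
    rw [hρ]
    field_simp
    norm_num
  have hη0 : 0 ≤ k ^ 2 / (20 * K) / 100 := by positivity
  have hε3 : (3 + 2 * K) ^ 4 * (σ * (K ^ 5)⁻¹) ≤ ρ * (K ^ 1)⁻¹ / 3 := by
    calc _ ≤ (M * K) ^ 4 * (σ * (K ^ 5)⁻¹) := by gcongr
      _ = _ := by
        rw [hσ]
        field_simp
  have hmain := RandomChirikov.pow_mul_leb_le_P2 (η := k ^ 2 / (20 * K)) hK0 (by positivity)
    (by linarith) (by field_simp; nlinarith) (by linarith)
    (by rw [hρη]; exact mul_le_of_le_one_left hη0 hk1)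
    (by rw [hρη]; exact mul_le_mul_of_nonneg_right hkK hη0)
    (by positivity) hε3 ha hA (s := n % 4) (Nat.mod_lt _ (by norm_num)) (n / 4 - 1) z hzU
  rw [show 4 * (n / 4 - 1) + (4 + n % 4) = n by omega] at hmain
  refine le_trans ?_ hmain
  rw [Measure.smul_apply, Measure.smul_apply, Measure.restrict_apply hA, smul_eq_mul, smul_eq_mul,
    ← mul_assoc, ← ENNReal.ofReal_mul (by positivity)]
  exact mul_le_mul' (ENNReal.ofReal_le_ofReal hcoef)
    (measure_mono (Set.inter_subset_inter_right _ hsubV))
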